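/- Let $n,m$ be positive integers with $n\ge 2m+2$, and let $G_1,\dots,G_{m+1}$ be (not necessarily distinct) simple graphs on the same vertex set $[n]=\{1,\dots,n\}$. Write $\rho(G)$ for the spectral radius of $G$, that is, the largest eigenvalue of its adjacency matrix. A rainbow matching for $G_1,\dots,G_{m+1}$ is a choice of pairwise disjoint edges $e_i\in E(G_i)$, $1\le i\le m+1$. Let $A^1_{n,m}=K_{2m+1}\cup (n-2m-1)K_1$ be the disjoint union of a complete graph on $2m+1$ vertices and $n-2m-1$ isolated vertices, and let $A^{m+1}_{n,m}=K_m\vee (n-m)K_1$ be the join of a complete graph on $m$ vertices and an edgeless graph on $n-m$ vertices (all edges between the two parts are present). Suppose that for every $i\in\{1,\dots,m+1\}$ $$\rho(G_i)\ \ge\ \max\Big\{2m,\ \tfrac12\Big(m-1+\sqrt{(m-1)^2+4m(n-m)}\Big)\Big\}.$$ Then: (1) if $2m+2\le n<3m+2$, then $G_1,\dots,G_{m+1}$ admit a rainbow matching unless $G_1=\dots=G_{m+1}\simeq A^1_{n,m}$; (2) if $n=3m+2$, then $G_1,\dots,G_{m+1}$ admit a rainbow matching unless $G_1=\dots=G_{m+1}\simeq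 A^{m+1}_{n,m}$ or $G_1=\dots=G_{m+1}\simeq A^1_{n,m}$; (3) if $n>3m+2$, then $G_1,\dots,G_{m+1}$ admit a rainbow matching unless $G_1=\dots=G_{m+1}\simeq A^{m+1}_{n,m}$. Here $=$ is equality of graphs on the vertex set $[n]$ and $\simeq$ is graph isomorphism; in each of the exceptional cases there is indeed no rainbow matching. -/

import Mathlib

/-- The spectral radius `ρ(G)` of a graph in the sense of spectral graph theory: the largest
(real) eigenvalue of its adjacency matrix. -/
noncomputable def graphSpectralRadius {V : Type*} [Fintype V] (G : SimpleGraph V) : ℝ :=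
  open Classical in
  sSup {μ : ℝ | Module.End.HasEigenvalue (Matrix.toLin' (G.adjMatrix ℝ)) μ}

/-- On a nonempty vertex set the largest eigenvalue exists, so the supremum above is a maximum. -/
theorem graphSpectralRadius_isGreatest {V : Type*} [Fintype V] [DecidableEq V] [Nonempty V]
    (G : SimpleGraph V) [DecidableRel G.Adj] :
    IsGreatest {μ : ℝ | Module.End.HasEigenvalue (Matrix.toLin' (G.adjMatrix ℝ)) μ}
      (graphSpectralRadius G) := by
  have hH : (G.adjMatrix ℝ).IsHermitian := by
    rw [Matrix.IsHermitian, Matrix.conjTranspose_eq_transpose_of_trivial]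
    exact G.transpose_adjMatrix (α := ℝ)
  have hne : {μ : ℝ | Module.End.HasEigenvalue (Matrix.toLin' (G.adjMatrix ℝ)) μ}.Nonempty := by
    obtain ⟨v⟩ := ‹Nonempty V›
    refine ⟨hH.eigenvalues v, ?_⟩
    change Module.End.HasEigenvalue _ _
    rw [Module.End.hasEigenvalue_iff_mem_spectrum, Matrix.spectrum_toLin']
    exact hH.eigenvalues_mem_spectrum_real v
  have hfin : {μ : ℝ | Module.End.HasEigenvalue (Matrix.toLin' (G.adjMatrix ℝ)) μ}.Finite :=
    Module.End.finite_hasEigenvalue _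
  have hs : graphSpectralRadius G =
      sSup {μ : ℝ | Module.End.HasEigenvalue (Matrix.toLin' (G.adjMatrix ℝ)) μ} := by
    unfold graphSpectralRadius
    congr!
  rw [hs]
  exact ⟨hne.csSup_mem hfin, fun x hx => le_csSup hfin.bddAbove hx⟩

/-- The family `G` of graphs on the same vertex set admits a rainbow matching: one can choose
an edge `e i` of each `G i` such that the chosen edges are pairwise disjoint. -/
def AdmitsRainbowMatching {ι V : Type*} (G : ι → SimpleGraph V) : Prop :=
  ∃ e : ι → Sym2 V, (∀ i, e i ∈ (G i).edgeSet) ∧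
    ∀ i j, i ≠ j → Disjoint (e i : Set V) (e j : Set V)

/-- The graph `A^i_{n,m} = K_{i-1} ∨ (K_{2m-2i+3} ∪ (n-2m+i-2) K_1)` on `n` vertices, where
`1 ≤ i ≤ m + 1` and `n ≥ 2m + 2`. The vertex with label `k ∈ {1, …, n}` is the element `k - 1` of
`Fin n`; the first complete graph lives on the labels `1, …, i - 1`, the second one on the labels
`i, …, 2m - i + 2`, and the remaining labels carry isolated vertices of the union. So two distinct
vertices are adjacent iff one of them has label at most `i - 1` or both have label at most
`2m - i + 2`. -/
def extremalGraph (n m i : ℕ) : SimpleGraph (Fin n) where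
  Adj u v := u ≠ v ∧ ((u : ℕ) + 1 ≤ i - 1 ∨ (v : ℕ) + 1 ≤ i - 1 ∨
    ((u : ℕ) + 1 ≤ 2 * m + 2 - i ∧ (v : ℕ) + 1 ≤ 2 * m + 2 - i))
  symm := ⟨fun _ _ h => ⟨h.1.symm, by tauto⟩⟩
  loopless := ⟨fun _ h => h.1 rfl⟩

/-- All members of the family are one and the same graph (equality of graphs on the common vertex
set), and this graph is isomorphic to `A`. -/
def AllEqualAndIso {ι V W : Type*} (G : ι → SimpleGraph V) (A : SimpleGraph W) : Prop :=
  (∀ i j, G i = G j) ∧ ∀ i, Nonempty (G i ≃g A)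

/-! To classify the families without a rainbow matching, only two properties of the lower bound c
for the radii are needed: 2m ≤ c and m(n - m) ≤ c² - (m - 1)c. They say that c is at least the
radius of either extremal graph. The tool is the Kelmans shift, applied to all graphs of the family
at once: it creates no rainbow matching (`AdmitsRainbowMatching.of_shiftGraph`) and lowers no radius
(`graphSpectralRadius_le_shiftGraph`).

Suppose that every shift towards a smaller label fixes the family. The pairs {j, 2m+1-j}, 0 ≤ j ≤ m,
partition the first 2m+2 vertices. A graph missing the pair of index s lies in a split graph: s
vertices joined to everything and a clique on the next 2m+1-2s. An explicit positive supersolution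
shows that its radius can reach c only if s = 0 or s = m and the graph is the full split graph
(`eq_splitGraph_of_le`). Each of these two graphs misses a single pair, so Hall's theorem builds a
rainbow matching from the pairs unless all graphs miss a common one (`exists_miss_of_stable`); in
that case they are the same extremal graph.

In general, take a counterexample maximising a potential that shifts increase. Its shift is a
constant extremal family. The equality case of the shift inequality makes each original graph that
extremal graph or its image under a transposition, and a family mixing the two has a rainbow
matching. Comparing 2m with the other radius gives the threshold n = 3m + 2. -/

/-! ### Rayleigh quotients, nonnegative eigenvectors and supersolutions -/

section Spectral
open Matrix
open scoped Classical

variable {V : Type*} [Fintype V]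

theorem posSemidef_smul_one_sub_adjMatrix [Nonempty V] (G : SimpleGraph V) :
    (graphSpectralRadius G • (1 : Matrix V V ℝ) - G.adjMatrix ℝ).PosSemidef := by
  have hA : (G.adjMatrix ℝ).IsHermitian := by
    rw [Matrix.IsHermitian, Matrix.conjTranspose_eq_transpose_of_trivial]
    exact G.transpose_adjMatrix (α := ℝ)
  have hH : (graphSpectralRadius G • (1 : Matrix V V ℝ) - G.adjMatrix ℝ).IsHermitian := by
    refine Matrix.IsHermitian.sub ?_ hA
    rw [Matrix.IsHermitian, Matrix.conjTranspose_smul, Matrix.conjTranspose_one]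
    simp
  rw [hH.posSemidef_iff_eigenvalues_nonneg]
  intro i
  have h := hH.mulVec_eigenvectorBasis i
  set x : V → ℝ := (hH.eigenvectorBasis i).ofLp with hx
  have hx0 : x ≠ 0 := by
    intro h0
    apply (hH.eigenvectorBasis.orthonormal.ne_zero i)
    ext j
    exact congrFun h0 j
  have h2 : (G.adjMatrix ℝ).mulVec x = (graphSpectralRadius G - hH.eigenvalues i) • x := by
    rw [Matrix.sub_mulVec, Matrix.smul_mulVec, Matrix.one_mulVec] at h
    rw [sub_smul, ← h]
    simp
  have h3 := (graphSpectralRadius_isGreatest G).2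
    (show graphSpectralRadius G - hH.eigenvalues i ∈ _ from
      Module.End.hasEigenvalue_of_hasEigenvector
        (Module.End.hasEigenvector_iff.2 ⟨Module.End.mem_eigenspace_iff.2 h2, hx0⟩))
  simpa using h3

/-- The Rayleigh quotient is bounded by the spectral radius. -/
theorem dotProduct_adjMatrix_mulVec_le [Nonempty V] (G : SimpleGraph V) (x : V → ℝ) :
    x ⬝ᵥ G.adjMatrix ℝ *ᵥ x ≤ graphSpectralRadius G * (x ⬝ᵥ x) := by
  have h := (posSemidef_smul_one_sub_adjMatrix G).dotProduct_mulVec_nonneg x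
  rw [Matrix.sub_mulVec, Matrix.smul_mulVec, Matrix.one_mulVec, dotProduct_sub,
    dotProduct_smul] at h
  simpa using h

/-- Equality in the Rayleigh bound puts `x` in the kernel of a positive semidefinite matrix. -/
theorem adjMatrix_mulVec_eq_of_le [Nonempty V] (G : SimpleGraph V) (x : V → ℝ)
    (h : graphSpectralRadius G * (x ⬝ᵥ x) ≤ x ⬝ᵥ G.adjMatrix ℝ *ᵥ x) :
    G.adjMatrix ℝ *ᵥ x = graphSpectralRadius G • x := by
  have h' := le_antisymm h (dotProduct_adjMatrix_mulVec_le G x)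
  have h0 := ((posSemidef_smul_one_sub_adjMatrix G).dotProduct_mulVec_zero_iff x).1 (by
    rw [Matrix.sub_mulVec, Matrix.smul_mulVec, Matrix.one_mulVec, dotProduct_sub,
      dotProduct_smul]
    simp [h'])
  rw [Matrix.sub_mulVec, Matrix.smul_mulVec, Matrix.one_mulVec] at h0
  exact (sub_eq_zero.1 h0).symm

/-- Taking entrywise absolute values of an eigenvector keeps its norm and does not lower the
quadratic form, so the Rayleigh bound is still attained. -/
theorem exists_nonneg_eigenvector [Nonempty V] (G : SimpleGraph V) :
    ∃ x : V → ℝ, (∀ v, 0 ≤ x v) ∧ x ≠ 0 ∧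
      G.adjMatrix ℝ *ᵥ x = graphSpectralRadius G • x := by
  obtain ⟨y, hy⟩ := (graphSpectralRadius_isGreatest G).1.exists_hasEigenvector
  have hy1 : G.adjMatrix ℝ *ᵥ y = graphSpectralRadius G • y := by
    simpa using Module.End.mem_eigenspace_iff.1 hy.1
  refine ⟨fun v => |y v|, fun v => abs_nonneg _, fun h => hy.2 (funext fun v => ?_), ?_⟩
  · simpa using congrFun h v
  · apply adjMatrix_mulVec_eq_of_le
    have e : (fun v => |y v|) ⬝ᵥ (fun v => |y v|) = y ⬝ᵥ y := by
      simp [dotProduct]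
    have e2 : graphSpectralRadius G * (y ⬝ᵥ y) = y ⬝ᵥ G.adjMatrix ℝ *ᵥ y := by
      rw [hy1, dotProduct_smul, smul_eq_mul]
    rw [e, e2]
    simp only [dotProduct, mulVec, Finset.mul_sum]
    refine Finset.sum_le_sum fun u _ => Finset.sum_le_sum fun v _ => ?_
    refine (le_abs_self _).trans (le_of_eq ?_)
    rw [abs_mul, abs_mul]
    congr 2
    rw [SimpleGraph.adjMatrix_apply]
    split_ifs <;> simp

/-- The support of a nonnegative eigenvector is closed under adjacency. -/
theorem pos_of_adj_of_pos {G : SimpleGraph V} {x : V → ℝ} {r : ℝ} (hx : ∀ v, 0 ≤ x v)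
    (h : G.adjMatrix ℝ *ᵥ x = r • x) {v w : V} (hv : 0 < x v) (hvw : G.Adj v w) : 0 < x w := by
  have h1 : ∑ u, G.adjMatrix ℝ w u * x u = r * x w := congrFun h w
  have h2 : G.adjMatrix ℝ w v * x v ≤ ∑ u, G.adjMatrix ℝ w u * x u :=
    Finset.single_le_sum (f := fun u => G.adjMatrix ℝ w u * x u) (fun u _ => by
      have := hx u
      rw [SimpleGraph.adjMatrix_apply]; split_ifs <;> simp [this]) (Finset.mem_univ v)
  rw [SimpleGraph.adjMatrix_apply, if_pos hvw.symm, one_mul] at h2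
  refine (hx w).lt_of_ne fun h0 => ?_
  rw [← h0, mul_zero] at h1
  linarith

theorem exists_pos_of_ne_zero {x : V → ℝ} (hx : ∀ v, 0 ≤ x v) (h : x ≠ 0) : ∃ v, 0 < x v := by
  by_contra! hc
  exact h (funext fun v => le_antisymm (hc v) (hx v))

theorem graphSpectralRadius_comap_le [Nonempty V] (G : SimpleGraph V) (σ : Equiv.Perm V) :
    graphSpectralRadius (G.comap σ) ≤ graphSpectralRadius G := by
  have hK : ∀ u v, (G.comap σ).Adj u v ↔ G.Adj (σ u) (σ v) := fun _ _ => Iff.rfl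
  generalize G.comap σ = K at hK ⊢
  obtain ⟨x, hx0, hx, he⟩ := exists_nonneg_eigenvector K
  have h := dotProduct_adjMatrix_mulVec_le G (x ∘ σ.symm)
  have e1 : (x ∘ σ.symm) ⬝ᵥ (x ∘ σ.symm) = x ⬝ᵥ x := by
    simp [dotProduct, Equiv.sum_comp σ.symm (fun v => x v * x v)]
  have e2 : (x ∘ σ.symm) ⬝ᵥ G.adjMatrix ℝ *ᵥ (x ∘ σ.symm) =
      x ⬝ᵥ K.adjMatrix ℝ *ᵥ x := by
    simp only [dotProduct, mulVec]
    rw [← Equiv.sum_comp σ]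
    refine Finset.sum_congr rfl fun u _ => ?_
    rw [← Equiv.sum_comp σ]
    simp [SimpleGraph.adjMatrix_apply, hK]
  rw [e1, e2, he, dotProduct_smul, smul_eq_mul] at h
  have hp : 0 < x ⬝ᵥ x := by
    have := dotProduct_self_star_pos_iff.2 hx
    simpa using this
  exact le_of_mul_le_mul_right h hp

/-- Comparison with a positive supersolution `y` of a supergraph `H`: the support of a nonnegative
eigenvector is a union of components of `H` on which `G` and `H` agree and `y` is an exact
solution. -/
theorem exists_closed_of_supersolution [Nonempty V] {G H : SimpleGraph V} (hGH : G ≤ H)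
    {y : V → ℝ} {c : ℝ} (hy : ∀ v, 0 < y v) (hle : ∀ v, (H.adjMatrix ℝ *ᵥ y) v ≤ c * y v)
    (hc : c ≤ graphSpectralRadius G) :
    graphSpectralRadius G = c ∧ ∃ P : Set V, P.Nonempty ∧ ∀ v ∈ P,
      (H.adjMatrix ℝ *ᵥ y) v = c * y v ∧ ∀ w, H.Adj v w → G.Adj v w ∧ w ∈ P := by
  obtain ⟨x, hx0, hx, he⟩ := exists_nonneg_eigenvector G
  have hGHy : ∀ v, (G.adjMatrix ℝ *ᵥ y) v ≤ (H.adjMatrix ℝ *ᵥ y) v := fun v => by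
    refine Finset.sum_le_sum fun w _ => mul_le_mul_of_nonneg_right ?_ (hy w).le
    simp only [SimpleGraph.adjMatrix_apply]
    by_cases h : G.Adj v w
    · simp [h, hGH h]
    · rw [if_neg h]; split_ifs <;> norm_num
  have hsym : x ⬝ᵥ G.adjMatrix ℝ *ᵥ y = graphSpectralRadius G * (x ⬝ᵥ y) := by
    rw [dotProduct_mulVec, ← mulVec_transpose, SimpleGraph.transpose_adjMatrix, he,
      smul_dotProduct, smul_eq_mul]
  obtain ⟨v0, hv0⟩ := exists_pos_of_ne_zero hx0 hx
  have hxy : 0 < x ⬝ᵥ y :=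
    Finset.sum_pos' (fun v _ => mul_nonneg (hx0 v) (hy v).le)
      ⟨v0, Finset.mem_univ _, mul_pos hv0 (hy v0)⟩
  have hnn : ∀ v ∈ Finset.univ, 0 ≤ x v * (c * y v - (G.adjMatrix ℝ *ᵥ y) v) := fun v _ =>
    mul_nonneg (hx0 v) (by linarith [hGHy v, hle v])
  -- The slack of `y` weighted by `x`. Its terms are nonnegative and c ≤ ρ(G), so ρ(G) = c and the
  -- slack vanishes on the support of `x`.
  have hsum : ∑ v, x v * (c * y v - (G.adjMatrix ℝ *ᵥ y) v) =
      (c - graphSpectralRadius G) * (x ⬝ᵥ y) := by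
    rw [sub_mul, ← hsym]
    simp only [dotProduct, mul_sub, Finset.sum_sub_distrib, Finset.mul_sum]
    congr 1
    exact Finset.sum_congr rfl fun v _ => by ring
  have hcr : graphSpectralRadius G = c := by
    have := hsum ▸ Finset.sum_nonneg hnn
    nlinarith
  refine ⟨hcr, {v | 0 < x v}, ⟨v0, hv0⟩, fun v hv => ?_⟩
  rw [hcr, sub_self, zero_mul, Finset.sum_eq_zero_iff_of_nonneg hnn] at hsum
  have hv1 : c * y v - (G.adjMatrix ℝ *ᵥ y) v = 0 :=
    (mul_eq_zero.1 (hsum v (Finset.mem_univ v))).resolve_left (ne_of_gt hv)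
  refine ⟨le_antisymm (hle v) (by linarith [hGHy v]), fun w hw => ?_⟩
  have hG : G.Adj v w := by
    by_contra hG
    have : (G.adjMatrix ℝ *ᵥ y) v < (H.adjMatrix ℝ *ᵥ y) v := by
      refine Finset.sum_lt_sum (fun w _ => mul_le_mul_of_nonneg_right ?_ (hy w).le)
        ⟨w, Finset.mem_univ w, ?_⟩
      · simp only [SimpleGraph.adjMatrix_apply]
        by_cases h : G.Adj v w
        · simp [h, hGH h]
        · rw [if_neg h]; split_ifs <;> norm_num
      · simp [SimpleGraph.adjMatrix_apply, hG, hw, hy w]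
    linarith [hle v]
  exact ⟨hG, pos_of_adj_of_pos hx0 he hv hG⟩

theorem graphSpectralRadius_le_of_supersolution [Nonempty V] {G : SimpleGraph V}
    {y : V → ℝ} {c : ℝ} (hy : ∀ v, 0 < y v) (hle : ∀ v, (G.adjMatrix ℝ *ᵥ y) v ≤ c * y v) :
    graphSpectralRadius G ≤ c := by
  by_contra! h
  exact h.ne' (exists_closed_of_supersolution le_rfl hy hle h.le).1

end Spectral

/-! ### Kelmans shifts: rainbow matchings and quadratic forms -/

section Shift
open Matrix
open scoped Classical

variable {V : Type*}

/-- The Kelmans shift from `b` to `a`: every edge `bv` such that `av` is not an edge is replaced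
by `av`. -/
def shiftGraph (a b : V) (G : SimpleGraph V) : SimpleGraph V where
  Adj u v := (G.Adj u v ∧ G.Adj (Equiv.swap a b u) (Equiv.swap a b v)) ∨
    ((u = a ∨ v = a) ∧ (G.Adj u v ∨ G.Adj (Equiv.swap a b u) (Equiv.swap a b v)))
  symm := ⟨fun u v h => by simpa only [G.adj_comm v, G.adj_comm (Equiv.swap a b v), or_comm] using h⟩
  loopless := ⟨fun u h => by simp at h⟩

theorem shiftGraph_adj {a b : V} {G : SimpleGraph V} {u v : V} : (shiftGraph a b G).Adj u v ↔
    (G.Adj u v ∧ G.Adj (Equiv.swap a b u) (Equiv.swap a b v)) ∨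
    ((u = a ∨ v = a) ∧ (G.Adj u v ∨ G.Adj (Equiv.swap a b u) (Equiv.swap a b v))) := Iff.rfl

/-- The neighbours of `b` which the shift from `b` to `a` moves to `a`. -/
def ShiftMoves (a b : V) (G : SimpleGraph V) (v : V) : Prop :=
  v ≠ a ∧ G.Adj b v ∧ ¬ G.Adj a v

/-- The two directions of a shift give isomorphic graphs, so the direction may be chosen to suit an
eigenvector. -/
theorem shiftGraph_swap (a b : V) (G : SimpleGraph V) :
    shiftGraph b a G = (shiftGraph a b G).comap (Equiv.swap a b) := by
  ext u v
  simp only [shiftGraph, SimpleGraph.comap_adj, Equiv.swap_apply_self, Equiv.swap_comm b a]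
  have h : ∀ w, Equiv.swap a b w = a ↔ w = b := fun w => by
    rw [Equiv.swap_apply_eq_iff, Equiv.swap_apply_left]
  rw [h, h]
  tauto

theorem shiftGraph_eq_self {a b : V} {G : SimpleGraph V} (h : ∀ v, ¬ ShiftMoves a b G v) :
    shiftGraph a b G = G := by
  have hb : ∀ v, v ≠ a → G.Adj b v → G.Adj a v := fun v hv hbv => by
    by_contra hc
    exact h v ⟨hv, hbv, hc⟩
  ext u v
  simp only [shiftGraph, Equiv.swap_apply_def]
  split_ifs <;> subst_vars <;> grind [G.adj_comm, SimpleGraph.irrefl]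

/-- A rainbow matching as an injective choice of end points. -/
theorem admitsRainbowMatching_iff {ι : Type*} {G : ι → SimpleGraph V} :
    AdmitsRainbowMatching G ↔ ∃ f : ι ⊕ ι → V, Function.Injective f ∧
      ∀ i, (G i).Adj (f (.inl i)) (f (.inr i)) := by
  constructor
  · rintro ⟨e, he, hd⟩
    have h : ∀ i, ∃ u v, e i = s(u, v) := fun i => by
      induction e i using Sym2.ind with | _ u v => exact ⟨u, v, rfl⟩
    choose u v huv using h
    have hadj : ∀ i, (G i).Adj (u i) (v i) := fun i => by
      have := he i
      rwa [huv, SimpleGraph.mem_edgeSet] at this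
    refine ⟨Sum.elim u v, ?_, hadj⟩
    have hne : ∀ i j, i ≠ j → u i ≠ u j ∧ u i ≠ v j ∧ v i ≠ v j := fun i j hij => by
      have := Set.disjoint_left.1 (hd i j hij)
      rw [huv, huv] at this
      have h1 := @this (u i) (by simp)
      have h2 := @this (v i) (by simp)
      simp at h1 h2
      tauto
    have hn := fun i => (hadj i).ne
    rintro (i | i) (j | j) h <;> by_cases hij : i = j <;> simp at h ⊢ <;>
      grind
  · rintro ⟨f, hf, hadj⟩
    refine ⟨fun i => s(f (.inl i), f (.inr i)), hadj, fun i j hij => ?_⟩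
    rw [Set.disjoint_left]
    intro w hw hw'
    simp only [SetLike.mem_coe, Sym2.mem_iff] at hw hw'
    rcases hw with rfl | rfl <;> rcases hw' with h | h <;> have := hf h <;> simp_all

/-- At most one edge of the matching meets `a`. If the shift created it, exchange `a` and `b` in the
whole matching: the other edges avoid `a`, and the shift keeps such an edge only if its swapped copy
was present too. -/
theorem AdmitsRainbowMatching.of_shiftGraph {ι : Type*} {G : ι → SimpleGraph V} {a b : V}
    (h : AdmitsRainbowMatching fun i => shiftGraph a b (G i)) : AdmitsRainbowMatching G := by
  rw [admitsRainbowMatching_iff] at h ⊢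
  obtain ⟨f, hf, hadj⟩ := h
  by_cases hc : ∃ i, (f (.inl i) = a ∨ f (.inr i) = a) ∧ ¬ (G i).Adj (f (.inl i)) (f (.inr i))
  · obtain ⟨i, hi, hni⟩ := hc
    refine ⟨fun z => Equiv.swap a b (f z), (Equiv.injective _).comp hf, fun j => ?_⟩
    rcases hadj j with h | ⟨h1, h2⟩
    · exact h.2
    · have hij : i = j := by
        rcases hi with hi | hi <;> rcases h1 with h1 | h1 <;>
          have := hf (hi.trans h1.symm) <;> simp_all
      subst hij
      exact h2.resolve_left hni
  · push Not at hc
    refine ⟨f, hf, fun j => ?_⟩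
    rcases hadj j with h | ⟨h1, h2⟩
    · exact h.1
    · exact hc j h1

/-- With w the indicator of the moved neighbours, the shift adds (e_a - e_b)wᵀ + w(e_a - e_b)ᵀ. -/
theorem adjMatrix_shiftGraph {a b : V} (hab : a ≠ b) (G : SimpleGraph V) (u v : V) :
    (shiftGraph a b G).adjMatrix ℝ u v = G.adjMatrix ℝ u v +
      ((if u = a then if ShiftMoves a b G v then 1 else 0 else 0) +
      (if v = a then if ShiftMoves a b G u then 1 else 0 else 0) -
      (if u = b then if ShiftMoves a b G v then 1 else 0 else 0) -
      (if v = b then if ShiftMoves a b G u then 1 else 0 else 0)) := by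
  simp only [SimpleGraph.adjMatrix_apply, shiftGraph_adj, ShiftMoves, Equiv.swap_apply_def]
  have hi := fun w => G.irrefl (v := w)
  have hs := fun w z => G.adj_comm w z
  by_cases h1 : u = a
  · subst h1
    by_cases h3 : v = u
    · subst h3; simp [hab]
    · by_cases h4 : v = b
      · subst h4; simp [hab, h3, hs]
      · simp only [hab, h3, h4, if_true, if_false]; grind
  by_cases h2 : u = b
  · subst h2
    by_cases h3 : v = a
    · subst h3; simp [hab, h1, hs]
    · by_cases h4 : v = u
      · subst h4; simp [h1]
      · simp only [h1, h3, h4, if_true, if_false]; grind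
  by_cases h3 : v = a
  · subst h3
    simp only [hab, h1, h2, if_true, if_false]; grind
  by_cases h4 : v = b
  · subst h4
    simp only [h1, h2, h3, if_true, if_false]; grind
  simp [h1, h2, h3, h4]

theorem dotProduct_adjMatrix_shiftGraph [Fintype V] {a b : V} (hab : a ≠ b) (G : SimpleGraph V) (x : V → ℝ) :
    x ⬝ᵥ (shiftGraph a b G).adjMatrix ℝ *ᵥ x = x ⬝ᵥ G.adjMatrix ℝ *ᵥ x +
      2 * (x a - x b) * ∑ v, if ShiftMoves a b G v then x v else 0 := by
  have key : ∀ u, ((shiftGraph a b G).adjMatrix ℝ *ᵥ x) u = (G.adjMatrix ℝ *ᵥ x) u +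
      ((if u = a then ∑ v, (if ShiftMoves a b G v then x v else 0) else 0) -
       (if u = b then ∑ v, (if ShiftMoves a b G v then x v else 0) else 0) +
       (x a - x b) * (if ShiftMoves a b G u then 1 else 0)) := fun u => by
    simp only [mulVec, dotProduct, adjMatrix_shiftGraph hab, add_mul, sub_mul,
      Finset.sum_add_distrib, Finset.sum_sub_distrib, ite_mul, zero_mul, one_mul,
      Finset.sum_ite_eq', Finset.mem_univ, if_true]
    split_ifs <;> simp <;> ring
  simp only [dotProduct, key, mul_add, Finset.sum_add_distrib, mul_sub (x _), Finset.sum_sub_distrib,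
    mul_ite, mul_zero, Finset.sum_ite_eq', Finset.mem_univ, if_true, mul_one]
  have : ∑ v, (if ShiftMoves a b G v then x v * x a - x v * x b else 0) =
      (x a - x b) * ∑ v, if ShiftMoves a b G v then x v else 0 := by
    rw [Finset.mul_sum]
    exact Finset.sum_congr rfl fun v _ => by split_ifs <;> ring
  rw [this]
  ring

end Shift

/-! ### Shifts and the spectral radius, with the equality case -/

section ShiftSpectral
open Matrix
open scoped Classical

variable {V : Type*}

theorem shiftGraph_adj_of_ne {a b : V} {G : SimpleGraph V} {u v : V} (hu : u ≠ a) (hu' : u ≠ b)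
    (hv : v ≠ a) (hv' : v ≠ b) : (shiftGraph a b G).Adj u v ↔ G.Adj u v := by
  simp [shiftGraph_adj, Equiv.swap_apply_of_ne_of_ne, *]

theorem shiftGraph_adj_left {a b : V} {G : SimpleGraph V} {v : V} (hv : v ≠ a) (hv' : v ≠ b) :
    (shiftGraph a b G).Adj a v ↔ G.Adj a v ∨ G.Adj b v := by
  simp [shiftGraph_adj, Equiv.swap_apply_of_ne_of_ne, *]
  tauto

theorem shiftGraph_adj_right {a b : V} (hab : a ≠ b) {G : SimpleGraph V} {v : V} (hv : v ≠ a)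
    (hv' : v ≠ b) : (shiftGraph a b G).Adj b v ↔ G.Adj a v ∧ G.Adj b v := by
  simp [shiftGraph_adj, Equiv.swap_apply_of_ne_of_ne, hab.symm, *]
  tauto

theorem shiftGraph_adj_pair {a b : V} {G : SimpleGraph V} :
    (shiftGraph a b G).Adj a b ↔ G.Adj a b := by
  simp [shiftGraph_adj, G.adj_comm b]

variable [Fintype V] [Nonempty V]

/-- `x` is a test vector for the shifted graph. If the radius does not grow, `x` is an eigenvector
of both graphs, and comparing the rows at `a` makes its entries at the moved neighbours sum to zero.
-/
theorem graphSpectralRadius_shiftGraph_aux {a b : V} (hab : a ≠ b) {G : SimpleGraph V}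
    {x : V → ℝ} (hx0 : ∀ v, 0 ≤ x v) (hx : x ≠ 0)
    (he : G.adjMatrix ℝ *ᵥ x = graphSpectralRadius G • x) (hxab : x b ≤ x a) :
    graphSpectralRadius G ≤ graphSpectralRadius (shiftGraph a b G) ∧
      (graphSpectralRadius (shiftGraph a b G) ≤ graphSpectralRadius G →
        ∀ v, ShiftMoves a b G v → x v = 0) := by
  have hp : 0 < x ⬝ᵥ x := by
    have := dotProduct_self_star_pos_iff.2 hx
    simpa using this
  have hs : ∀ v ∈ Finset.univ, 0 ≤ if ShiftMoves a b G v then x v else 0 := fun v _ => by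
    split_ifs
    exacts [hx0 v, le_rfl]
  have hQ := dotProduct_adjMatrix_shiftGraph hab G x
  rw [he, dotProduct_smul, smul_eq_mul] at hQ
  have hge : graphSpectralRadius G * (x ⬝ᵥ x) ≤ x ⬝ᵥ (shiftGraph a b G).adjMatrix ℝ *ᵥ x := by
    rw [hQ]
    have := mul_nonneg (sub_nonneg.2 hxab) (Finset.sum_nonneg hs)
    linarith
  have hle := le_of_mul_le_mul_right
    (hge.trans (dotProduct_adjMatrix_mulVec_le (shiftGraph a b G) x)) hp
  refine ⟨hle, fun hle' v hv => ?_⟩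
  have heq := le_antisymm hle' hle
  have he' := adjMatrix_mulVec_eq_of_le (shiftGraph a b G) x (heq ▸ hge)
  have hrow : ((shiftGraph a b G).adjMatrix ℝ *ᵥ x) a = (G.adjMatrix ℝ *ᵥ x) a +
      ∑ v, if ShiftMoves a b G v then x v else 0 := by
    have ha : ¬ ShiftMoves a b G a := fun h => h.1 rfl
    simp only [mulVec, dotProduct, adjMatrix_shiftGraph hab, if_neg ha, if_neg hab, if_true,
      add_mul, Finset.sum_add_distrib, ite_self, sub_zero, add_zero, ite_mul, one_mul, zero_mul]
  rw [he', heq, he, left_eq_add] at hrow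
  have := (Finset.sum_eq_zero_iff_of_nonneg hs).1 hrow v (Finset.mem_univ v)
  rwa [if_pos hv] at this

theorem graphSpectralRadius_shiftGraph_swap (a b : V) (G : SimpleGraph V) :
    graphSpectralRadius (shiftGraph b a G) ≤ graphSpectralRadius (shiftGraph a b G) := by
  rw [shiftGraph_swap]
  exact graphSpectralRadius_comap_le _ _

/-- Kelmans shifts do not decrease the spectral radius. -/
theorem graphSpectralRadius_le_shiftGraph {a b : V} (hab : a ≠ b) (G : SimpleGraph V) :
    graphSpectralRadius G ≤ graphSpectralRadius (shiftGraph a b G) := by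
  obtain ⟨x, hx0, hx, he⟩ := exists_nonneg_eigenvector G
  rcases le_total (x b) (x a) with h | h
  · exact (graphSpectralRadius_shiftGraph_aux hab hx0 hx he h).1
  · exact (graphSpectralRadius_shiftGraph_aux hab.symm hx0 hx he h).1.trans
      (graphSpectralRadius_shiftGraph_swap a b G)

/-- If a shift does not increase the spectral radius and every vertex whose adjacency to `a` and `b`
differs lies in every nontrivial component, then one of the two shifts fixes the graph. -/
theorem shiftGraph_eq_self_or_of_radius_le {a b : V} (hab : a ≠ b) {G : SimpleGraph V}
    (hpos : 0 < graphSpectralRadius G)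
    (hle : graphSpectralRadius (shiftGraph a b G) ≤ graphSpectralRadius G)
    (hP : ∀ P : Set V, ∀ p ∈ P, ∀ q ∈ P, G.Adj p q → (∀ v ∈ P, ∀ w, G.Adj v w → w ∈ P) →
      ∀ v, v ≠ a → v ≠ b → ¬ (G.Adj a v ↔ G.Adj b v) → v ∈ P) :
    shiftGraph a b G = G ∨ shiftGraph b a G = G := by
  obtain ⟨x, hx0, hx, he⟩ := exists_nonneg_eigenvector G
  obtain ⟨p, hp⟩ := exists_pos_of_ne_zero hx0 hx
  have hcl : ∀ v ∈ {v | 0 < x v}, ∀ w, G.Adj v w → w ∈ {v | 0 < x v} := fun v hv w hw =>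
    pos_of_adj_of_pos hx0 he hv hw
  obtain ⟨q, hq⟩ : ∃ q, G.Adj p q := by
    by_contra! hc
    have h1 : ∑ u, G.adjMatrix ℝ p u * x u = graphSpectralRadius G * x p := congrFun he p
    simp only [SimpleGraph.adjMatrix_apply, hc, if_false, zero_mul, Finset.sum_const_zero] at h1
    exact (mul_pos hpos hp).ne h1
  have hin := hP _ p hp q (hcl p hp q hq) hq hcl
  rcases le_total (x b) (x a) with h | h
  · left
    refine shiftGraph_eq_self fun v hv => ?_
    have h0 := (graphSpectralRadius_shiftGraph_aux hab hx0 hx he h).2 hle v hv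
    exact (hin v hv.1 hv.2.1.ne' (fun h => hv.2.2 (h.2 hv.2.1))).ne' h0
  · right
    refine shiftGraph_eq_self fun v hv => ?_
    have h0 := (graphSpectralRadius_shiftGraph_aux hab.symm hx0 hx he h).2
      ((graphSpectralRadius_shiftGraph_swap a b G).trans hle) v hv
    exact (hin v hv.2.1.ne' hv.1 (fun h => hv.2.2 (h.1 hv.2.1))).ne' h0

end ShiftSpectral

/-! ### Split graphs: undoing a shift, and radius bounds -/

section SplitGraph
open Matrix
open scoped Classical

variable {V : Type*}

/-- The graph in which `S` is joined to everything and `T` is a clique. -/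
def splitGraph (S T : Finset V) : SimpleGraph V where
  Adj u v := u ≠ v ∧ (u ∈ S ∨ v ∈ S ∨ (u ∈ T ∧ v ∈ T))
  symm := ⟨fun _ _ h => ⟨h.1.symm, by tauto⟩⟩
  loopless := ⟨fun _ h => h.1 rfl⟩

theorem splitGraph_adj {S T : Finset V} {u v : V} :
    (splitGraph S T).Adj u v ↔ u ≠ v ∧ (u ∈ S ∨ v ∈ S ∨ (u ∈ T ∧ v ∈ T)) := Iff.rfl

theorem splitGraph_comap (S T : Finset V) (σ : Equiv.Perm V) :
    (splitGraph S T).comap σ =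
      splitGraph (S.map σ.symm.toEmbedding) (T.map σ.symm.toEmbedding) := by
  ext u v
  simp [splitGraph_adj, Finset.mem_map_equiv]

variable [Fintype V]

/-- A vertex v telling `a` from `b` forces a, v ∈ K and b ∉ K. Then ab is not an edge, so every edge
has an end in K other than `a`, `b`, which equals v or is adjacent to it: v lies in every nontrivial
component. -/
theorem eq_clique_of_shiftGraph_eq [Nonempty V] {a b : V} (hab : a ≠ b) {G : SimpleGraph V}
    {K : Finset V} (hpos : 0 < graphSpectralRadius G)
    (hle : graphSpectralRadius (shiftGraph a b G) ≤ graphSpectralRadius G)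
    (h : shiftGraph a b G = splitGraph ∅ K) :
    G = splitGraph ∅ K ∨ G = splitGraph ∅ (K.map (Equiv.swap a b).toEmbedding) := by
  have h0 := fun u v (hu : u ≠ a) (hu' : u ≠ b) (hv : v ≠ a) (hv' : v ≠ b) =>
    h ▸ shiftGraph_adj_of_ne (G := G) hu hu' hv hv'
  have h1 := fun v (hv : v ≠ a) (hv' : v ≠ b) => h ▸ shiftGraph_adj_left (G := G) hv hv'
  have h2 := fun v (hv : v ≠ a) (hv' : v ≠ b) => h ▸ shiftGraph_adj_right hab (G := G) hv hv'
  have h3 := h ▸ shiftGraph_adj_pair (a := a) (b := b) (G := G)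
  simp only [splitGraph_adj, Finset.notMem_empty, false_or] at h0 h1 h2 h3
  suffices hP : shiftGraph a b G = G ∨ shiftGraph b a G = G by
    rcases hP with h' | h'
    · exact .inl (h'.symm.trans h)
    · right
      rw [← h', shiftGraph_swap, h, splitGraph_comap]
      simp only [Equiv.symm_swap, Finset.map_empty]
  refine shiftGraph_eq_self_or_of_radius_le hab hpos hle ?_
  · intro P p hp q hq hpq hcl v hva hvb hv
    have hvK := h1 v hva hvb
    have hvb' := h2 v hva hvb
    have haK : a ∈ K := by tauto
    have hv' : v ∈ K := by tauto
    have hbK : b ∉ K := fun hb => hv (by have := hvb'.1 ⟨hvb.symm, hb, hv'⟩; tauto)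
    obtain ⟨c, hc, hca, hcb, hcK⟩ : ∃ c ∈ P, c ≠ a ∧ c ≠ b ∧ c ∈ K := by
      have hs := fun w z => G.adj_comm w z
      have := hpq.ne
      by_cases hpa : p = a <;> by_cases hpb : p = b <;> by_cases hqa : q = a <;>
        by_cases hqb : q = b <;> first | (exact ⟨p, hp, by grind⟩) | (exact ⟨q, hq, by grind⟩)
    by_cases hvc : v = c
    · exact hvc ▸ hc
    · exact hcl c hc v ((h0 c v hca hcb hva hvb).1 ⟨Ne.symm hvc, hcK, hv'⟩)

/-- If some vertex tells `a` from `b`, then a ∈ M, ab is an edge and every other vertex is adjacent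
to `a` or `b`, so `G` is connected. -/
theorem eq_cover_of_shiftGraph_eq [Nonempty V] {a b : V} (hab : a ≠ b) {G : SimpleGraph V}
    {M : Finset V} (hpos : 0 < graphSpectralRadius G)
    (hle : graphSpectralRadius (shiftGraph a b G) ≤ graphSpectralRadius G)
    (h : shiftGraph a b G = splitGraph M ∅) :
    G = splitGraph M ∅ ∨ G = splitGraph (M.map (Equiv.swap a b).toEmbedding) ∅ := by
  have h1 := fun v (hv : v ≠ a) (hv' : v ≠ b) => h ▸ shiftGraph_adj_left (G := G) hv hv'
  have h2 := fun v (hv : v ≠ a) (hv' : v ≠ b) => h ▸ shiftGraph_adj_right hab (G := G) hv hv'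
  have h3 := h ▸ shiftGraph_adj_pair (a := a) (b := b) (G := G)
  simp only [splitGraph_adj, Finset.notMem_empty, false_and, or_false] at h1 h2 h3
  suffices hP : shiftGraph a b G = G ∨ shiftGraph b a G = G by
    rcases hP with h' | h'
    · exact .inl (h'.symm.trans h)
    · right
      rw [← h', shiftGraph_swap, h, splitGraph_comap]
      simp only [Equiv.symm_swap, Finset.map_empty]
  refine shiftGraph_eq_self_or_of_radius_le hab hpos hle ?_
  · intro P p hp q hq hpq hcl v hva hvb hv
    have hbM : b ∉ M := fun hb => hv (by have := (h2 v hva hvb).1 ⟨hvb.symm, .inl hb⟩; tauto)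
    have hvM : v ∉ M := fun hb => hv (by have := (h2 v hva hvb).1 ⟨hvb.symm, .inr hb⟩; tauto)
    have hvK := h1 v hva hvb
    have haM : a ∈ M := by tauto
    have hGab : G.Adj a b := h3.1 ⟨hab, .inl haM⟩
    have hor : a ∈ P ∨ b ∈ P := by
      by_cases hpa : p = a
      · exact .inl (hpa ▸ hp)
      by_cases hpb : p = b
      · exact .inr (hpb ▸ hp)
      rcases (h1 p hpa hpb).1 ⟨Ne.symm hpa, .inl haM⟩ with h | h
      · exact .inl (hcl p hp a h.symm)
      · exact .inr (hcl p hp b h.symm)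
    have ha : a ∈ P := hor.elim id fun h => hcl b h a hGab.symm
    have hb : b ∈ P := hcl a ha b hGab
    rcases hvK.1 ⟨hva.symm, .inl haM⟩ with h | h
    · exact hcl a ha v h
    · exact hcl b hb v h

/-- `S`, `T` and the rest form an equitable partition; this is its quotient action, normalised to 1
on `S`. -/
theorem splitGraph_mulVec {S T : Finset V} (hST : Disjoint S T) (β γ : ℝ) (v : V) :
    ((splitGraph S T).adjMatrix ℝ *ᵥ fun w => if w ∈ S then 1 else if w ∈ T then β else γ) v =
      if v ∈ S then (S.card - 1 : ℝ) + T.card * β + (Fintype.card V - S.card - T.card) * γ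
      else if v ∈ T then S.card + (T.card - 1) * β else S.card := by
  have hd : ∀ w, w ∈ S → w ∉ T := fun w hw => Finset.disjoint_left.1 hST hw
  simp only [mulVec, dotProduct]
  by_cases hS : v ∈ S
  · rw [if_pos hS, Finset.sum_congr rfl (g := fun w => (if w ∈ S then 1 else 0) +
      (if w ∈ T then β else 0) + γ - (if w ∈ S then γ else 0) - (if w ∈ T then γ else 0) -
      if w = v then 1 else 0)]
    · simp [Finset.sum_add_distrib, Finset.sum_sub_distrib]
      ring
    · intro w _
      have := hd w
      rw [SimpleGraph.adjMatrix_apply, splitGraph_adj]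
      by_cases h1 : w = v
      · subst h1; simp_all
      · by_cases h2 : w ∈ S <;> by_cases h3 : w ∈ T <;> simp_all [Ne.symm h1, eq_comm]
  · rw [if_neg hS]
    by_cases hT : v ∈ T
    · rw [if_pos hT, Finset.sum_congr rfl (g := fun w => (if w ∈ S then 1 else 0) +
        (if w ∈ T then β else 0) - if w = v then β else 0)]
      · simp [Finset.sum_add_distrib, Finset.sum_sub_distrib]
        ring
      · intro w _
        have := hd w
        rw [SimpleGraph.adjMatrix_apply, splitGraph_adj]
        by_cases h1 : w = v
        · subst h1; simp_all
        · by_cases h2 : w ∈ S <;> by_cases h3 : w ∈ T <;> simp_all [Ne.symm h1, eq_comm]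
    · rw [if_neg hT, Finset.sum_congr rfl (g := fun w => (if w ∈ S then 1 else 0))]
      · simp
      · intro w _
        rw [SimpleGraph.adjMatrix_apply, splitGraph_adj]
        by_cases h1 : w = v
        · subst h1; simp_all
        · by_cases h2 : w ∈ S <;> simp_all [Ne.symm h1, eq_comm]

theorem graphSpectralRadius_clique_le [Nonempty V] {K : Finset V} {m : ℕ}
    (hK : K.card = 2 * m + 1) : graphSpectralRadius (splitGraph ∅ K) ≤ 2 * m := by
  refine graphSpectralRadius_le_of_supersolution
    -- The constant vector 1, in the shape that `splitGraph_mulVec` expects.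
    (y := fun w => if w ∈ (∅ : Finset V) then 1 else if w ∈ K then 1 else 1) (fun v => by simp)
    fun v => ?_
  rw [splitGraph_mulVec (by simp)]
  simp only [Finset.notMem_empty, if_false, ite_self, hK]
  split_ifs <;> push_cast <;> simp

theorem graphSpectralRadius_cover_le [Nonempty V] {M : Finset V} {m : ℕ} (hm : 1 ≤ m)
    (hM : M.card = m) {c : ℝ} (hc0 : 0 < c)
    (hc : m * (Fintype.card V - m : ℝ) ≤ c ^ 2 - (m - 1) * c) :
    graphSpectralRadius (splitGraph M ∅) ≤ c := by
  have hm' : (0 : ℝ) < m := by exact_mod_cast hm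
  refine graphSpectralRadius_le_of_supersolution
    (y := fun w => if w ∈ M then 1 else if w ∈ (∅ : Finset V) then 1 else m / c) (fun v => ?_)
    fun v => ?_
  · split_ifs <;> positivity
  rw [splitGraph_mulVec (by simp)]
  simp only [Finset.notMem_empty, if_false, hM]
  split_ifs
  · have : (Fintype.card V - m : ℝ) * (m / c) ≤ c - (m - 1) := by
      rw [← mul_div_assoc, div_le_iff₀ hc0]
      linarith
    simp
    linarith
  · rw [mul_div_cancel₀ _ hc0.ne']

/-- A subgraph of a split graph attaining the extremal spectral radius is one of the two extreme
split graphs. -/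
theorem eq_splitGraph_of_le [Nonempty V] {S T : Finset V} (hST : Disjoint S T) {m : ℕ}
    (hm : 1 ≤ m) (hS : S.card ≤ m) (hT : T.card + 2 * S.card = 2 * m + 1) {c : ℝ}
    (hc2 : 2 * m ≤ c) (hc : m * (Fintype.card V - m : ℝ) ≤ c ^ 2 - (m - 1) * c)
    {G : SimpleGraph V} (hG : G ≤ splitGraph S T) (hcG : c ≤ graphSpectralRadius G) :
    (S.card = 0 ∨ S.card = m) ∧ G = splitGraph S T := by
  have hm' : (1 : ℝ) ≤ m := by exact_mod_cast hm
  have hT' : (T.card : ℝ) = 2 * m + 1 - 2 * S.card := by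
    have : (T.card + 2 * S.card : ℝ) = 2 * m + 1 := by exact_mod_cast hT
    linarith
  rcases Nat.eq_zero_or_pos S.card with hs | hs
  · refine ⟨.inl hs, ?_⟩
    rw [Finset.card_eq_zero] at hs
    subst hs
    obtain ⟨-, P, ⟨p, hp⟩, hP⟩ := exists_closed_of_supersolution hG (c := c)
      (y := fun w => if w ∈ (∅ : Finset V) then 1 else if w ∈ T then 1 else 1)
      (fun v => by simp) (fun v => by
        rw [splitGraph_mulVec hST]
        simp only [Finset.notMem_empty, if_false, ite_self, hT']
        split_ifs <;> simp <;> linarith) hcG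
    have hpT : p ∈ T := by
      by_contra hpT
      have := (hP p hp).1
      rw [splitGraph_mulVec hST] at this
      simp [hpT] at this
      linarith
    have hall : ∀ v ∈ T, v ∈ P := fun v hv => by
      by_cases h : p = v
      · exact h ▸ hp
      · exact ((hP p hp).2 v ⟨h, .inr (.inr ⟨hpT, hv⟩)⟩).2
    refine le_antisymm hG fun u v huv => ((hP u (hall u ?_)).2 v huv).1
    simpa using (show u ∈ T from by simpa using huv.2.resolve_left (by simp) |>.resolve_left (by simp) |>.1)
  · have hs1 : (1 : ℝ) ≤ S.card := by exact_mod_cast hs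
    have hsm : (S.card : ℝ) ≤ m := by exact_mod_cast hS
    set s : ℝ := (S.card : ℝ) with hsdef
    have hc0 : 0 < c := by linarith
    have hD : 0 < c - 2 * m + 2 * s := by linarith
    have hD' := hD.ne'
    have hm0 : (m : ℝ) ≠ 0 := by linarith
    -- The values s/(c - 2m + 2s) on `T` and s/c outside solve their rows exactly, so only the rows
    -- of `S` have slack. Bounding the order by m + c(c - m + 1)/m bounds that slack below by a
    -- positive multiple of m - s.
    have hgap : (m - s) * ((c + 1) * (c - 2 * m) / (c * (c - 2 * m + 2 * s)) + (c - m + 1) / m +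
        (s - 1) / c) ≤ c - ((s - 1) + (2 * m + 1 - 2 * s) * (s / (c - 2 * m + 2 * s)) +
          (Fintype.card V - s - (2 * m + 1 - 2 * s)) * (s / c)) := by
      have h1 : (m - s) * ((c + 1) * (c - 2 * m) / (c * (c - 2 * m + 2 * s)) + (c - m + 1) / m +
        (s - 1) / c) = c - ((s - 1) + (2 * m + 1 - 2 * s) * (s / (c - 2 * m + 2 * s)) +
          (s - m - 1 + c * (c - m + 1) / m) * (s / c)) := by
        generalize hE : c - 2 * m + 2 * s = D at hD'
        field_simp
        rw [← hE]
        ring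
      rw [h1]
      have h2 : (Fintype.card V - m : ℝ) ≤ c * (c - m + 1) / m := by
        rw [le_div_iff₀ (by linarith)]
        linarith
      have h3 : (Fintype.card V - s - (2 * m + 1 - 2 * s)) * (s / c) ≤
          (s - m - 1 + c * (c - m + 1) / m) * (s / c) :=
        mul_le_mul_of_nonneg_right (by linarith) (by positivity)
      linarith
    have hpos : 0 < (c + 1) * (c - 2 * m) / (c * (c - 2 * m + 2 * s)) + (c - m + 1) / m +
        (s - 1) / c := by
      have h1 : 0 ≤ (c + 1) * (c - 2 * m) / (c * (c - 2 * m + 2 * s)) :=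
        div_nonneg (mul_nonneg (by linarith) (by linarith)) (by positivity)
      have h2 : 0 < (c - m + 1) / m := div_pos (by linarith) (by linarith)
      have h3 : 0 ≤ (s - 1) / c := div_nonneg (by linarith) hc0.le
      linarith
    obtain ⟨-, P, ⟨p, hp⟩, hP⟩ := exists_closed_of_supersolution hG (c := c)
      (y := fun w => if w ∈ S then 1 else if w ∈ T then s / (c - 2 * m + 2 * s) else s / c)
      (fun v => by split_ifs <;> positivity) (fun v => by
        rw [splitGraph_mulVec hST]
        simp only [hT', ← hsdef]
        split_ifs
        · have := mul_nonneg (sub_nonneg.2 hsm) hpos.le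
          linarith
        · apply le_of_eq
          generalize hE : c - 2 * m + 2 * s = D at hD'
          field_simp
          rw [← hE]
          ring
        · rw [mul_div_cancel₀ _ hc0.ne']) hcG
    obtain ⟨z, hz⟩ := Finset.card_pos.1 hs
    have hzP : z ∈ P := by
      by_cases h : p = z
      · exact h ▸ hp
      · exact ((hP p hp).2 z ⟨h, .inr (.inl hz)⟩).2
    have hall : ∀ v, v ∈ P := fun v => by
      by_cases h : z = v
      · exact h ▸ hzP
      · exact ((hP z hzP).2 v ⟨h, .inl hz⟩).2
    refine ⟨.inr ?_, le_antisymm hG fun u v huv => ((hP u (hall u)).2 v huv).1⟩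
    have h1 := (hP z hzP).1
    rw [splitGraph_mulVec hST] at h1
    simp only [hT', ← hsdef, if_pos hz] at h1
    have h2 : (m - s) * ((c + 1) * (c - 2 * m) / (c * (c - 2 * m + 2 * s)) + (c - m + 1) / m +
        (s - 1) / c) ≤ 0 := by linarith
    have h3 : (m : ℝ) ≤ s := by
      by_contra! h
      exact absurd (mul_pos (sub_pos.2 h) hpos) (not_lt.2 h2)
    rw [hsdef] at h3
    exact le_antisymm hS (by exact_mod_cast h3)

end SplitGraph

/-! ### Rainbow matchings in extremal and mixed families -/

section Rainbow
open scoped Classical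

variable {V ι : Type*}

theorem not_admitsRainbowMatching_clique [Fintype ι] {K : Finset V} {G : ι → SimpleGraph V}
    (hK : K.card < 2 * Fintype.card ι) (hG : ∀ i, G i = splitGraph ∅ K) :
    ¬ AdmitsRainbowMatching G := by
  rw [admitsRainbowMatching_iff]
  rintro ⟨f, hf, hadj⟩
  have hmem : ∀ z ∈ (Finset.univ : Finset (ι ⊕ ι)), f z ∈ K := by
    rintro (i | i) - <;> have := hadj i <;> simp [hG, splitGraph_adj] at this <;> tauto
  have := Finset.card_le_card_of_injOn f hmem hf.injOn
  simp at this
  omega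

theorem not_admitsRainbowMatching_cover [Fintype ι] {M : Finset V} {G : ι → SimpleGraph V}
    (hM : M.card < Fintype.card ι) (hG : ∀ i, G i = splitGraph M ∅) :
    ¬ AdmitsRainbowMatching G := by
  rw [admitsRainbowMatching_iff]
  rintro ⟨f, hf, hadj⟩
  have h : ∀ i, ∃ z : ι ⊕ ι, (z = .inl i ∨ z = .inr i) ∧ f z ∈ M := fun i => by
    have := hadj i
    simp only [hG, splitGraph_adj, Finset.notMem_empty, false_and, or_false] at this
    rcases this.2 with h | h
    exacts [⟨_, .inl rfl, h⟩, ⟨_, .inr rfl, h⟩]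
  choose z hz hzM using h
  have hinj : Function.Injective z := fun i j hij => by
    rcases hz i with h | h <;> rcases hz j with h' | h' <;> rw [h, h'] at hij <;> simp_all
  have := Finset.card_le_card_of_injOn (s := Finset.univ) (fun i => f (z i))
    (fun i _ => hzM i) (hf.comp hinj).injOn
  simp at this
  omega

/-- K ∪ {b} has exactly enough vertices for all the ends. With `a` in edge i and `b` in edge j,
every other edge lies in K ∩ K'. -/
theorem admitsRainbowMatching_of_two_cliques [Fintype ι] {G : ι → SimpleGraph V} {a b : V} {K K' : Finset V}
    (ha : a ∈ K) (hb : b ∉ K) (hK' : ∀ u, u ∈ K' ↔ u = b ∨ (u ∈ K ∧ u ≠ a))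
    (hK : K.card + 1 = 2 * Fintype.card ι)
    (hG : ∀ i, G i = splitGraph ∅ K ∨ G i = splitGraph ∅ K') {i j : ι} (hij : i ≠ j)
    (hi : G i = splitGraph ∅ K) (hj : G j = splitGraph ∅ K') : AdmitsRainbowMatching G := by
  rw [admitsRainbowMatching_iff]
  have hab : a ≠ b := fun h => hb (h ▸ ha)
  obtain ⟨g, hg⟩ := Finset.exists_equiv_extend_of_card_eq (α := ι ⊕ ι) (t := insert b K)
    (by rw [Finset.card_insert_of_notMem hb, hK, Fintype.card_sum]; ring)
    (s := {.inl i, .inl j}) (f := fun z => if z = .inl i then a else b)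
    (by intro u hu; simp at hu; grind)
    (by intro u hu v hv h; simp at hu hv h; grind)
  have hgi : (g (.inl i) : V) = a := by rw [hg _ (by simp)]; simp
  have hgj : (g (.inl j) : V) = b := by rw [hg _ (by simp)]; simp [hij.symm]
  have hinj : Function.Injective fun z => (g z : V) := Subtype.val_injective.comp g.injective
  have hne : ∀ z, z ≠ .inl i → (g z : V) ≠ a := fun z hz h => hz (hinj (h.trans hgi.symm))
  have hne' : ∀ z, z ≠ .inl j → (g z : V) ≠ b := fun z hz h => hz (hinj (h.trans hgj.symm))
  have hmem : ∀ z, (g z : V) = b ∨ (g z : V) ∈ K := fun z => Finset.mem_insert.1 (g z).2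
  refine ⟨fun z => g z, hinj, fun k => ?_⟩
  have hk : (g (.inl k) : V) ≠ g (.inr k) := hinj.ne (by simp)
  have hcl : ∀ {H : SimpleGraph V} {L : Finset V}, H = splitGraph ∅ L → (g (.inl k) : V) ∈ L →
      (g (.inr k) : V) ∈ L → H.Adj (g (.inl k)) (g (.inr k)) := fun h h1 h2 => by
    rw [h]; exact ⟨hk, .inr (.inr ⟨h1, h2⟩)⟩
  by_cases hki : k = i
  · subst hki
    exact hcl hi (hgi ▸ ha) ((hmem _).resolve_left (hne' _ (by simp)))
  by_cases hkj : k = j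
  · subst hkj
    exact hcl hj (by rw [hgj, hK']; exact .inl rfl)
      ((hK' _).2 (.inr ⟨(hmem _).resolve_left (hne' _ (by simp)), hne _ (by simp)⟩))
  have h1 := (hmem (.inl k)).resolve_left (hne' _ (by simpa using hkj))
  have h2 := (hmem (.inr k)).resolve_left (hne' _ (by simp))
  rcases hG k with h | h
  · exact hcl h h1 h2
  · exact hcl h ((hK' _).2 (.inr ⟨h1, hne _ (by simpa using hki)⟩))
      ((hK' _).2 (.inr ⟨h2, hne _ (by simp)⟩))

/-- Anchor edge i at `a`, edge j at `b` and the others in M ∩ M'; `hV` leaves enough vertices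
outside M ∪ {b} for the second ends. -/
theorem admitsRainbowMatching_of_two_covers [Fintype ι] [Fintype V] {G : ι → SimpleGraph V} {a b : V} {M M' : Finset V}
    (ha : a ∈ M) (hb : b ∉ M) (hM' : ∀ u, u ∈ M' ↔ u = b ∨ (u ∈ M ∧ u ≠ a))
    (hM : M.card + 1 = Fintype.card ι) (hV : 2 * Fintype.card ι ≤ Fintype.card V)
    (hG : ∀ i, G i = splitGraph M ∅ ∨ G i = splitGraph M' ∅) {i j : ι} (hij : i ≠ j)
    (hi : G i = splitGraph M ∅) (hj : G j = splitGraph M' ∅) : AdmitsRainbowMatching G := by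
  rw [admitsRainbowMatching_iff]
  have hab : a ≠ b := fun h => hb (h ▸ ha)
  have hcard : (insert b M).card = Fintype.card ι := by rw [Finset.card_insert_of_notMem hb, hM]
  obtain ⟨g, hg⟩ := Finset.exists_equiv_extend_of_card_eq (α := ι) (t := insert b M) hcard.symm
    (s := {i, j}) (f := fun z => if z = i then a else b)
    (by intro u hu; simp at hu; grind)
    (by intro u hu v hv h; simp at hu hv h; grind)
  have hgi : (g i : V) = a := by rw [hg _ (by simp)]; simp
  have hgj : (g j : V) = b := by rw [hg _ (by simp)]; simp [hij.symm]
  have hinj : Function.Injective fun z => (g z : V) := Subtype.val_injective.comp g.injective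
  obtain ⟨l⟩ := Function.Embedding.nonempty_of_card_le (α := ι) (β := ((insert b M)ᶜ : Finset V))
    (by rw [Fintype.card_coe, Finset.card_compl, hcard]; omega)
  have hl : ∀ k, (l k : V) ∉ insert b M := fun k => Finset.mem_compl.1 (l k).2
  refine ⟨Sum.elim (fun z => g z) (fun z => l z), ?_, fun k => ?_⟩
  · refine hinj.sumElim (Subtype.val_injective.comp l.injective) fun x y h => hl y ?_
    exact h ▸ (g x).2
  have hk : (g k : V) ≠ l k := fun h => hl k (h ▸ (g k).2)
  have hmem : (g k : V) = b ∨ (g k : V) ∈ M := Finset.mem_insert.1 (g k).2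
  have hcl : ∀ {H : SimpleGraph V} {L : Finset V}, H = splitGraph L ∅ → (g k : V) ∈ L →
      H.Adj (g k) (l k) := fun h h1 => by rw [h]; exact ⟨hk, .inl h1⟩
  have hMk : k ≠ j → (g k : V) ∈ M := fun h => hmem.resolve_left
    fun h' => h (hinj (h'.trans hgj.symm))
  by_cases hki : k = i
  · exact hcl (hki ▸ hi) (hMk (hki ▸ hij))
  by_cases hkj : k = j
  · subst hkj
    exact hcl hj ((hM' _).2 (.inl hgj))
  rcases hG k with h | h
  · exact hcl h (hMk hkj)
  · exact hcl h ((hM' _).2 (.inr ⟨hMk hkj, fun h' => hki (hinj (h'.trans hgi.symm))⟩))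

/-- If every member of the family is one of two graphs of the same kind, whose defining sets differ
by a transposition, and mixed families have a rainbow matching, then the family is constant. -/
theorem exists_forall_eq_of_swap {G : ι → SimpleGraph V} {F : Finset V → SimpleGraph V} {k : ℕ}
    (hmix : ∀ (a b : V) (K K' : Finset V), K.card = k → a ∈ K → b ∉ K →
      (∀ u, u ∈ K' ↔ u = b ∨ (u ∈ K ∧ u ≠ a)) → (∀ i, G i = F K ∨ G i = F K') →
      ∀ i j, i ≠ j → G i = F K → G j = F K' → AdmitsRainbowMatching G)
    (hno : ¬ AdmitsRainbowMatching G) {a b : V} {K : Finset V} (hK : K.card = k)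
    (h : ∀ i, G i = F K ∨ G i = F (K.map (Equiv.swap a b).toEmbedding)) :
    ∃ K : Finset V, K.card = k ∧ ∀ i, G i = F K := by
  by_contra! hc
  obtain ⟨j, hj⟩ := hc K hK
  obtain ⟨i, hi⟩ := hc (K.map (Equiv.swap a b).toEmbedding) (by rw [Finset.card_map, hK])
  have hj' := (h j).resolve_left hj
  have hi' := (h i).resolve_right hi
  have hij : i ≠ j := fun e => hj (e ▸ hi')
  have hmem : ∀ u, u ∈ K.map (Equiv.swap a b).toEmbedding ↔ Equiv.swap a b u ∈ K := fun u => by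
    rw [Finset.mem_map_equiv, Equiv.symm_swap]
  by_cases ha : a ∈ K <;> by_cases hb : b ∈ K
  · refine hj (hj'.trans (congrArg F (Finset.ext fun u => ?_)))
    rw [hmem, Equiv.swap_apply_def]; grind
  · refine hno (hmix a b K _ hK ha hb (fun u => ?_) h i j hij hi' hj')
    rw [hmem, Equiv.swap_apply_def]; grind
  · refine hno (hmix b a K _ hK hb ha (fun u => ?_) h i j hij hi' hj')
    rw [hmem, Equiv.swap_apply_def]; grind
  · refine hj (hj'.trans (congrArg F (Finset.ext fun u => ?_)))
    rw [hmem, Equiv.swap_apply_def]; grind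

end Rainbow

/-! ### Shift-stable families and the reduction to them -/

section Stable
open Matrix
open scoped Classical

theorem Fin.card_filter_val_lt_of_le {n k : ℕ} (h : k ≤ n) :
    (Finset.univ.filter fun v : Fin n => (v : ℕ) < k).card = k := by
  rw [Fin.card_filter_val_lt, min_eq_right h]

theorem adj_of_stable {n : ℕ} {G : SimpleGraph (Fin n)} (hst : ∀ a b, a < b → shiftGraph a b G = G)
    {a b v : Fin n} (hab : a ≤ b) (hva : v ≠ a) (h : G.Adj b v) : G.Adj a v := by
  rcases hab.eq_or_lt with rfl | hab
  · exact h
  · rw [← hst a b hab, shiftGraph_adj_left hva h.ne']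
    exact .inr h

/-- An edge outside the split graph has one end ≥ s and the other ≥ 2m+1-s, so stability pushes it
down to the missing pair; s ≤ m keeps the ends distinct. -/
theorem le_splitGraph_of_stable {n m s : ℕ} (hn : 2 * m + 2 ≤ n) (hs : s ≤ m)
    {G : SimpleGraph (Fin n)} (hst : ∀ a b, a < b → shiftGraph a b G = G)
    (hmiss : ¬ G.Adj ⟨s, by omega⟩ ⟨2 * m + 1 - s, by omega⟩) :
    G ≤ splitGraph (Finset.univ.filter fun v : Fin n => (v : ℕ) < s)
      (Finset.univ.filter fun v : Fin n => s ≤ (v : ℕ) ∧ (v : ℕ) < 2 * m + 1 - s) := by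
  have key : ∀ u v : Fin n, G.Adj u v → s ≤ (u : ℕ) → 2 * m + 1 - s ≤ (v : ℕ) → False := by
    intro u v huv hu hv
    have h1 : G.Adj ⟨s, by omega⟩ v := adj_of_stable hst (Fin.mk_le_of_le_val hu)
      (Fin.ne_of_val_ne (by simp; omega)) huv
    exact hmiss (adj_of_stable hst (Fin.mk_le_of_le_val hv)
      (Fin.ne_of_val_ne (by simp; omega)) h1.symm).symm
  intro u v huv
  refine ⟨huv.ne, ?_⟩
  by_contra! hc
  simp only [Finset.mem_filter, Finset.mem_univ, true_and, not_lt] at hc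
  obtain ⟨hu, hv, h⟩ := hc
  by_cases hu' : (u : ℕ) < 2 * m + 1 - s
  · exact key u v huv hu (by simpa [hv] using h ⟨hu, hu'⟩)
  · exact key v u huv.symm hv (by omega)

theorem eq_splitGraph_of_stable {n m s : ℕ} (hm : 1 ≤ m) (hn : 2 * m + 2 ≤ n) (hs : s ≤ m) {c : ℝ}
    (hc2 : 2 * m ≤ c) (hc : m * (n - m : ℝ) ≤ c ^ 2 - (m - 1) * c)
    {G : SimpleGraph (Fin n)} (hst : ∀ a b, a < b → shiftGraph a b G = G)
    (hcG : c ≤ graphSpectralRadius G)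
    (hmiss : ¬ G.Adj ⟨s, by omega⟩ ⟨2 * m + 1 - s, by omega⟩) :
    (s = 0 ∧ G = splitGraph ∅ (Finset.univ.filter fun v : Fin n => (v : ℕ) < 2 * m + 1)) ∨
    (s = m ∧ G = splitGraph (Finset.univ.filter fun v : Fin n => (v : ℕ) < m) ∅) := by
  have : Nonempty (Fin n) := ⟨⟨0, by omega⟩⟩
  have hS : (Finset.univ.filter fun v : Fin n => (v : ℕ) < s).card = s :=
    Fin.card_filter_val_lt_of_le (by omega)
  have hT : (Finset.univ.filter fun v : Fin n => s ≤ (v : ℕ) ∧ (v : ℕ) < 2 * m + 1 - s).card =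
      2 * m + 1 - 2 * s := by
    have h1 : (Finset.univ.filter fun v : Fin n => s ≤ (v : ℕ) ∧ (v : ℕ) < 2 * m + 1 - s) =
        (Finset.univ.filter fun v : Fin n => (v : ℕ) < 2 * m + 1 - s) \
          (Finset.univ.filter fun v : Fin n => (v : ℕ) < s) := by
      ext v; simp; tauto
    rw [h1, Finset.card_sdiff_of_subset, hS, Fin.card_filter_val_lt_of_le (by omega)]
    · omega
    · intro v; simp; omega
  have hd : Disjoint (Finset.univ.filter fun v : Fin n => (v : ℕ) < s)
      (Finset.univ.filter fun v : Fin n => s ≤ (v : ℕ) ∧ (v : ℕ) < 2 * m + 1 - s) :=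
    Finset.disjoint_left.2 fun v => by simp; omega
  obtain ⟨h, hG⟩ := eq_splitGraph_of_le hd hm
    (by rw [hS]; exact hs) (by rw [hS, hT]; omega) hc2 (by rwa [Fintype.card_fin])
    (le_splitGraph_of_stable hn hs hst hmiss) hcG
  rw [hS] at h
  rcases h with rfl | rfl
  · left
    refine ⟨rfl, hG.trans ?_⟩
    ext u v
    simp [splitGraph_adj]
  · right
    refine ⟨rfl, hG.trans ?_⟩
    ext u v
    simp only [splitGraph_adj, Finset.mem_filter, Finset.mem_univ, true_and, Finset.notMem_empty,
      false_and, or_false, ne_eq, Fin.ext_iff]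
    omega

theorem exists_miss_of_stable {n m : ℕ} (hm : 1 ≤ m) (hn : 2 * m + 2 ≤ n) {c : ℝ}
    (hc2 : 2 * m ≤ c) (hc : m * (n - m : ℝ) ≤ c ^ 2 - (m - 1) * c)
    {G : Fin (m + 1) → SimpleGraph (Fin n)}
    (hst : ∀ i a b, a < b → shiftGraph a b (G i) = G i)
    (hcG : ∀ i, c ≤ graphSpectralRadius (G i)) (hno : ¬ AdmitsRainbowMatching G) :
    ∃ j : Fin (m + 1), ∀ i, ¬ (G i).Adj ⟨j, by omega⟩ ⟨2 * m + 1 - j, by omega⟩ := by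
  by_contra! hc'
  apply hno
  let t : Fin (m + 1) → Finset (Fin (m + 1)) := fun i =>
    Finset.univ.filter fun j => (G i).Adj ⟨j, by omega⟩ ⟨2 * m + 1 - j, by omega⟩
  have hmiss : ∀ i j, j ∉ t i ↔ ¬ (G i).Adj ⟨j, by omega⟩ ⟨2 * m + 1 - j, by omega⟩ :=
    fun i j => by simp [t]
  have huniq : ∀ i j j', j ∉ t i → j' ∉ t i → j = j' := by
    intro i j j' hj hj'
    have hj1 := (hmiss i j).1 hj
    have hj1' := (hmiss i j').1 hj'
    by_contra hne
    have hne := Fin.val_ne_of_ne hne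
    have hl := j.2
    have hl' := j'.2
    rcases eq_splitGraph_of_stable hm hn (by omega) hc2 hc (hst i) (hcG i) hj1 with ⟨h0, h⟩ | ⟨h0, h⟩
    · rw [h] at hj1'
      apply hj1'
      simp [splitGraph_adj]
      omega
    · rw [h] at hj1'
      apply hj1'
      simp [splitGraph_adj]
      omega
  -- Hall's condition: each graph misses at most one of the m + 1 pairs, which settles proper
  -- subfamilies, and the whole family covers every pair by `hc'`.
  obtain ⟨π, hπ, hπt⟩ := (Finset.all_card_le_biUnion_card_iff_exists_injective t).1 (by
    intro s
    rcases s.eq_empty_or_nonempty with rfl | ⟨i, hi⟩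
    · simp
    by_cases hs : s = Finset.univ
    · have : s.biUnion t = Finset.univ := by
        ext j
        obtain ⟨i, hi⟩ := hc' j
        simp only [hs, Finset.mem_biUnion, Finset.mem_univ, true_and, iff_true]
        exact ⟨i, by simpa [t] using hi⟩
      rw [this]
      exact Finset.card_le_univ s
    · have h1 : s.card < m + 1 := by
        simpa using Finset.card_lt_card (Finset.ssubset_univ_iff.2 hs)
      have h2 : (t i)ᶜ.card ≤ 1 := Finset.card_le_one.2 fun j hj j' hj' =>
        huniq i j j' (Finset.mem_compl.1 hj) (Finset.mem_compl.1 hj')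
      have h3 := Finset.card_add_card_compl (t i)
      have h4 := Finset.card_le_card (Finset.subset_biUnion_of_mem t hi)
      rw [Fintype.card_fin] at h3
      omega)
  rw [admitsRainbowMatching_iff]
  refine ⟨Sum.elim (fun i => ⟨π i, by omega⟩) (fun i => ⟨2 * m + 1 - π i, by omega⟩), ?_,
    fun i => by simpa [t] using hπt i⟩
  have hl := fun i => (π i).2
  rintro (i | i) (j | j) h <;> have h1 := hl i <;> have h2 := hl j <;>
    simp only [Sum.elim_inl, Sum.elim_inr, Fin.mk.injEq] at h
  · exact congrArg _ (hπ (Fin.ext h))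
  · omega
  · omega
  · exact congrArg _ (hπ (Fin.ext (by omega)))

/-- Families of large spectral radius without a rainbow matching are constant, equal to a complete
graph on `2m + 1` vertices or to all edges meeting a set of `m` vertices. -/
theorem eq_extremal_of_not_admitsRainbowMatching {n m : ℕ} (hm : 1 ≤ m) (hn : 2 * m + 2 ≤ n) {c : ℝ}
    (hc2 : 2 * m ≤ c) (hc : m * (n - m : ℝ) ≤ c ^ 2 - (m - 1) * c)
    (G : Fin (m + 1) → SimpleGraph (Fin n)) (hcG : ∀ i, c ≤ graphSpectralRadius (G i))
    (hno : ¬ AdmitsRainbowMatching G) :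
    (∃ K : Finset (Fin n), K.card = 2 * m + 1 ∧ ∀ i, G i = splitGraph ∅ K) ∨
    (∃ M : Finset (Fin n), M.card = m ∧ ∀ i, G i = splitGraph M ∅) := by
  have : Nonempty (Fin n) := ⟨⟨0, by omega⟩⟩
  have hm' : (1 : ℝ) ≤ m := by exact_mod_cast hm
  by_contra hbad
  -- Positive weights decreasing in the label: a shift to a smaller label that moves an edge
  -- strictly raises the quadratic form.
  let x : Fin n → ℝ := fun v => n - (v : ℕ)
  have hx : ∀ v, 0 < x v := fun v => sub_pos.2 (by exact_mod_cast v.2)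
  have hxlt : ∀ a b, a < b → x b < x a := fun a b h =>
    sub_lt_sub_left (by exact_mod_cast h) _
  obtain ⟨G, ⟨hcG, hno, hbad⟩, hmax⟩ := Set.exists_max_image
    {G : Fin (m + 1) → SimpleGraph (Fin n) | (∀ i, c ≤ graphSpectralRadius (G i)) ∧
      ¬ AdmitsRainbowMatching G ∧
      ¬ ((∃ K : Finset (Fin n), K.card = 2 * m + 1 ∧ ∀ i, G i = splitGraph ∅ K) ∨
        (∃ M : Finset (Fin n), M.card = m ∧ ∀ i, G i = splitGraph M ∅))}
    (fun G => ∑ i, x ⬝ᵥ (G i).adjMatrix ℝ *ᵥ x) (Set.toFinite _) ⟨G, hcG, hno, hbad⟩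
  by_cases hst : ∀ i a b, a < b → shiftGraph a b (G i) = G i
  · obtain ⟨j, hj⟩ := exists_miss_of_stable hm hn hc2 hc hst hcG hno
    have hjm : (j : ℕ) ≤ m := by omega
    have h := fun i => eq_splitGraph_of_stable hm hn hjm hc2 hc (hst i) (hcG i) (hj i)
    apply hbad
    by_cases h0 : (j : ℕ) = 0
    · refine .inl ⟨_, Fin.card_filter_val_lt_of_le (by omega), fun i => ?_⟩
      rcases h i with h | h
      · exact h.2
      · omega
    · refine .inr ⟨_, Fin.card_filter_val_lt_of_le (by omega), fun i => ?_⟩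
      rcases h i with h | h
      · omega
      · exact h.2
  · push Not at hst
    obtain ⟨k, a, b, hab, hk⟩ := hst
    have hle := fun i => graphSpectralRadius_le_shiftGraph hab.ne (G i)
    have hsum0 : ∀ i, 0 ≤ ∑ v, if ShiftMoves a b (G i) v then x v else 0 := fun i =>
      Finset.sum_nonneg fun v _ => by split_ifs; exacts [(hx v).le, le_rfl]
    have hlt : ∑ i, x ⬝ᵥ (G i).adjMatrix ℝ *ᵥ x <
        ∑ i, x ⬝ᵥ (shiftGraph a b (G i)).adjMatrix ℝ *ᵥ x := by
      have h2 := hxlt a b hab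
      refine Finset.sum_lt_sum (fun i _ => ?_) ⟨k, Finset.mem_univ k, ?_⟩
      · rw [dotProduct_adjMatrix_shiftGraph hab.ne]
        have := mul_nonneg (sub_pos.2 h2).le (hsum0 i)
        linarith
      · rw [dotProduct_adjMatrix_shiftGraph hab.ne]
        have h3 : 0 < ∑ v, if ShiftMoves a b (G k) v then x v else 0 := by
          refine (hsum0 k).lt_of_ne fun h0 => hk (shiftGraph_eq_self fun v hv => ?_)
          have := (Finset.sum_eq_zero_iff_of_nonneg (fun v _ => by
            split_ifs; exacts [(hx v).le, le_rfl])).1 h0.symm v (Finset.mem_univ v)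
          rw [if_pos hv] at this
          exact (hx v).ne' this
        have := mul_pos (sub_pos.2 h2) h3
        linarith
    have hgood : (∃ K : Finset (Fin n), K.card = 2 * m + 1 ∧
          ∀ i, shiftGraph a b (G i) = splitGraph ∅ K) ∨
        (∃ M : Finset (Fin n), M.card = m ∧ ∀ i, shiftGraph a b (G i) = splitGraph M ∅) := by
      by_contra hbad'
      exact (hmax (fun i => shiftGraph a b (G i)) ⟨fun i => (hcG i).trans (hle i),
        fun h => hno h.of_shiftGraph, hbad'⟩).not_gt hlt
    have hpos : ∀ i, 0 < graphSpectralRadius (G i) := fun i => by linarith [hcG i]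
    apply hbad
    rcases hgood with ⟨K, hK, h⟩ | ⟨M, hM, h⟩
    · left
      refine exists_forall_eq_of_swap (F := splitGraph ∅) (a := a) (b := b)
        (fun a b K K' hK ha hb hK' hG i j hij hi hj => admitsRainbowMatching_of_two_cliques
          ha hb hK' (by simp [hK]; ring) hG hij hi hj) hno hK fun i =>
        eq_clique_of_shiftGraph_eq hab.ne (hpos i) ?_ (h i)
      rw [h i]
      exact (graphSpectralRadius_clique_le hK).trans (hc2.trans (hcG i))
    · right
      refine exists_forall_eq_of_swap (F := fun M => splitGraph M ∅) (a := a) (b := b)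
        (fun a b K K' hK ha hb hK' hG i j hij hi hj => admitsRainbowMatching_of_two_covers
          ha hb hK' (by simp [hK]) (by simp; omega) hG hij hi hj) hno hM fun i =>
        eq_cover_of_shiftGraph_eq hab.ne (hpos i) ?_ (h i)
      rw [h i]
      exact (graphSpectralRadius_cover_le hm hM (by linarith)
        (by rwa [Fintype.card_fin])).trans (hcG i)

end Stable

/-! ### The extremal graphs as split graphs -/

section Extremal
open scoped Classical

theorem splitGraph_map_iso {V : Type*} (S T : Finset V) (e : Equiv.Perm V) :
    Nonempty (splitGraph S T ≃g splitGraph (S.map e.toEmbedding) (T.map e.toEmbedding)) :=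
  ⟨⟨e, fun {u v} => by simp [splitGraph_adj]⟩⟩

theorem eq_splitGraph_of_iso {V : Type*} {G : SimpleGraph V} {S T : Finset V}
    (φ : G ≃g splitGraph S T) :
    G = splitGraph (S.map φ.toEquiv.symm.toEmbedding) (T.map φ.toEquiv.symm.toEmbedding) := by
  ext u v
  rw [← φ.map_adj_iff]
  simp only [splitGraph_adj, Finset.mem_map_equiv, Equiv.symm_symm, ne_eq]
  exact and_congr_left fun _ => not_congr φ.injective.eq_iff

theorem extremalGraph_one (n m : ℕ) : extremalGraph n m 1 =
    splitGraph ∅ (Finset.univ.filter fun v : Fin n => (v : ℕ) < 2 * m + 1) := by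
  ext u v
  simp only [extremalGraph, splitGraph_adj, Finset.mem_filter, Finset.mem_univ, true_and,
    Finset.notMem_empty, false_or]
  omega

theorem extremalGraph_succ (n m : ℕ) : extremalGraph n m (m + 1) =
    splitGraph (Finset.univ.filter fun v : Fin n => (v : ℕ) < m) ∅ := by
  ext u v
  simp only [extremalGraph, splitGraph_adj, Finset.mem_filter, Finset.mem_univ, true_and,
    Finset.notMem_empty, false_and, or_false, ne_eq, Fin.ext_iff]
  omega

theorem allEqualAndIso_clique_iff {n m : ℕ} (hn : 2 * m + 2 ≤ n)
    {G : Fin (m + 1) → SimpleGraph (Fin n)} : AllEqualAndIso G (extremalGraph n m 1) ↔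
      ∃ K : Finset (Fin n), K.card = 2 * m + 1 ∧ ∀ i, G i = splitGraph ∅ K := by
  have hcard : (Finset.univ.filter fun v : Fin n => (v : ℕ) < 2 * m + 1).card = 2 * m + 1 :=
    Fin.card_filter_val_lt_of_le (by omega)
  rw [extremalGraph_one]
  constructor
  · rintro ⟨heq, hiso⟩
    obtain ⟨φ⟩ := hiso 0
    refine ⟨_, (Finset.card_map φ.toEquiv.symm.toEmbedding).trans hcard, fun i => ?_⟩
    rw [heq i 0]
    simpa only [Finset.map_empty] using eq_splitGraph_of_iso φ
  · rintro ⟨K, hK, h⟩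
    refine ⟨fun i j => (h i).trans (h j).symm, fun i => ?_⟩
    obtain ⟨e, he⟩ := Equiv.Perm.exists_map_finset_eq _ _ (hK.trans hcard.symm)
    rw [h i, ← he]
    simpa only [Finset.map_empty] using splitGraph_map_iso ∅ K e

theorem allEqualAndIso_cover_iff {n m : ℕ} (hn : 2 * m + 2 ≤ n)
    {G : Fin (m + 1) → SimpleGraph (Fin n)} : AllEqualAndIso G (extremalGraph n m (m + 1)) ↔
      ∃ M : Finset (Fin n), M.card = m ∧ ∀ i, G i = splitGraph M ∅ := by
  have hcard : (Finset.univ.filter fun v : Fin n => (v : ℕ) < m).card = m :=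
    Fin.card_filter_val_lt_of_le (by omega)
  rw [extremalGraph_succ]
  constructor
  · rintro ⟨heq, hiso⟩
    obtain ⟨φ⟩ := hiso 0
    refine ⟨_, (Finset.card_map φ.toEquiv.symm.toEmbedding).trans hcard, fun i => ?_⟩
    rw [heq i 0]
    simpa only [Finset.map_empty] using eq_splitGraph_of_iso φ
  · rintro ⟨K, hK, h⟩
    refine ⟨fun i j => (h i).trans (h j).symm, fun i => ?_⟩
    obtain ⟨e, he⟩ := Equiv.Perm.exists_map_finset_eq _ _ (hK.trans hcard.symm)
    rw [h i, ← he]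
    simpa only [Finset.map_empty] using splitGraph_map_iso K ∅ e

end Extremal

/-! ### The threshold n = 3m + 2 -/

theorem theorem1p3 (n m : ℕ) (hm : 1 ≤ m) (hn : 2 * m + 2 ≤ n)
    (G : Fin (m + 1) → SimpleGraph (Fin n))
    (hG : ∀ i, max (2 * (m : ℝ))
        (1 / 2 * ((m : ℝ) - 1 + √(((m : ℝ) - 1) ^ 2 + 4 * (m : ℝ) * ((n : ℝ) - (m : ℝ)))))
      ≤ graphSpectralRadius (G i)) :
    (n < 3 * m + 2 →
      (AdmitsRainbowMatching G ↔ ¬ AllEqualAndIso G (extremalGraph n m 1))) ∧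
    (n = 3 * m + 2 →
      (AdmitsRainbowMatching G ↔
        ¬ (AllEqualAndIso G (extremalGraph n m (m + 1)) ∨
          AllEqualAndIso G (extremalGraph n m 1)))) ∧
    (3 * m + 2 < n →
      (AdmitsRainbowMatching G ↔ ¬ AllEqualAndIso G (extremalGraph n m (m + 1)))) := by
  have : Nonempty (Fin n) := ⟨⟨0, by omega⟩⟩
  have hm' : (1 : ℝ) ≤ m := by exact_mod_cast hm
  have hn' : (2 * m + 2 : ℝ) ≤ n := by exact_mod_cast hn
  rw [allEqualAndIso_clique_iff hn, allEqualAndIso_cover_iff hn]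
  have hclique : (∃ K : Finset (Fin n), K.card = 2 * m + 1 ∧ ∀ i, G i = splitGraph ∅ K) →
      ¬ AdmitsRainbowMatching G := fun ⟨K, hK, h⟩ =>
    not_admitsRainbowMatching_clique (by simp [hK]; omega) h
  have hcover : (∃ M : Finset (Fin n), M.card = m ∧ ∀ i, G i = splitGraph M ∅) →
      ¬ AdmitsRainbowMatching G := fun ⟨M, hM, h⟩ =>
    not_admitsRainbowMatching_cover (by simp [hM]) h
  set r : ℝ := 1 / 2 * ((m : ℝ) - 1 + √(((m : ℝ) - 1) ^ 2 + 4 * (m : ℝ) * ((n : ℝ) - (m : ℝ))))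
    with hr
  have hmn : 0 < (m : ℝ) * (n - m) := mul_pos (by linarith) (by linarith)
  have hsq := Real.sq_sqrt (show 0 ≤ ((m : ℝ) - 1) ^ 2 + 4 * (m : ℝ) * ((n : ℝ) - (m : ℝ)) by
    nlinarith [sq_nonneg ((m : ℝ) - 1)])
  have hrm : (m : ℝ) - 1 < r := by
    have := Real.lt_sqrt_of_sq_lt (show ((m : ℝ) - 1) ^ 2 <
      ((m : ℝ) - 1) ^ 2 + 4 * (m : ℝ) * ((n : ℝ) - (m : ℝ)) by nlinarith)
    rw [hr]
    linarith
  -- r is the larger root of λ² - (m - 1)λ - m(n - m), whose value at λ = 2m is m(3m + 2 - n).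
  -- Cliques force r ≤ 2m and covers force 2m ≤ r, which decides the cases.
  have hroot : r ^ 2 - (m - 1) * r = m * (n - m) := by
    have h2 : √(((m : ℝ) - 1) ^ 2 + 4 * (m : ℝ) * ((n : ℝ) - (m : ℝ))) = 2 * r - (m - 1) := by
      rw [hr]; ring
    rw [h2] at hsq
    linarith
  have hmono : ∀ c, r ≤ c → m * (n - m : ℝ) ≤ c ^ 2 - (m - 1) * c := fun c hc => by
    have := mul_nonneg (sub_nonneg.2 hc) (show 0 ≤ c + r - (m - 1) by linarith)
    linarith
  have hmain : ¬ AdmitsRainbowMatching G → _ := eq_extremal_of_not_admitsRainbowMatching hm hn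
    (le_max_left _ _) (hmono _ (le_max_right _ _)) G hG
  have hle : (∃ K : Finset (Fin n), K.card = 2 * m + 1 ∧ ∀ i, G i = splitGraph ∅ K) →
      n ≤ 3 * m + 2 := fun ⟨K, hK, h⟩ => by
    have h1 := ((le_max_right _ _).trans (hG 0)).trans
      (h 0 ▸ graphSpectralRadius_clique_le hK)
    have h2 := hmono _ h1
    have h3 : (n : ℝ) ≤ 3 * m + 2 := by
      by_contra! h
      nlinarith
    exact_mod_cast h3
  have hge : (∃ M : Finset (Fin n), M.card = m ∧ ∀ i, G i = splitGraph M ∅) →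
      3 * m + 2 ≤ n := fun ⟨M, hM, h⟩ => by
    have h1 := ((le_max_left _ _).trans (hG 0)).trans
      (h 0 ▸ graphSpectralRadius_cover_le (c := r) hm hM (by linarith)
        (by rw [Fintype.card_fin]; exact hroot.ge))
    have h3 : (3 * m + 2 : ℝ) ≤ n := by
      by_contra! h
      have := mul_nonneg (sub_nonneg.2 h1) (show 0 ≤ r + 2 * m - (m - 1) by linarith)
      nlinarith
    exact_mod_cast h3
  refine ⟨fun hlt => ⟨fun h h' => hclique h' h, fun h => ?_⟩,
    fun heq => ⟨fun h h' => h'.elim (hcover · h) (hclique · h), fun h => ?_⟩,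
    fun hlt => ⟨fun h h' => hcover h' h, fun h => ?_⟩⟩ <;> by_contra hno
  · exact (hmain hno).elim h fun h' => by have := hge h'; omega
  · exact h (hmain hno).symm
  · exact (hmain hno).elim (fun h' => by have := hle h'; omega) h
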